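/- Conventions. Let $(G,*)$ be a topological group and $X\subseteq G$. Let $\mathcal O$ be the collection of all open covers of $G$, and $\mathcal O_X$ the collection of all covers of $X$ by sets open in $G$. For an open neighborhood $U$ of the identity put $\mathcal O(U)=\{x*U : x\in G\}$, and let $\mathcal O_{nbd}$ be the collection of all covers of the form $\mathcal O(U)$. Let $\Omega$ be the collection of all open $\omega$-covers of $G$, that is, open covers $\mathcal U$ with $G\notin\mathcal U$ such that each finite $F\subseteq G$ is contained in some $U\in\mathcal U$. For collections $\mathcal A,\mathcal B$, the selection principle $S_1(\mathcal A,\mathcal B)$ states that for each sequence $(A_n:n<\omega)$ of members of $\mathcal A$ there are $b_n\in A_n$ with $\{b_n:n<\omega\}\in\mathcal B$. In the game $G_1(\mathcal A,\mathcal B)$, in inning $n<\omega$ ONE chooses $O_n\in\mathcal A$ and then TWO chooses $T_n\in O_n$; TWO wins if $\{T_n:n<\omega\}\in\mathcal B$, and otherwise ONE wins. The relation $\mathcal A\to(\mathcal B)^2_k$ states that for each $A\in\mathcal A$ and each function $f:[A]^2\to\{1,\dots,k\}$ on the two-element subsets of $A$ there are $B\subseteq A$ with $B\in\mathcal B$ and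 $i\in\{1,\dots,k\}$ such that $f$ has constant value $i$ on $[B]^2$. The set $X$ is called Rothberger bounded in $G$ if $S_1(\mathcal O_{nbd},\mathcal O_X)$ holds. Theorem. Let $(G,*)$ be a $\sigma$-compact topological group and let $X$ be a subset of $G$. The following are equivalent: (1) $S_1(\mathcal O,\mathcal O_X)$ holds. (2) $S_1(\mathcal O_{nbd},\mathcal O_X)$ holds. (3) $X$ is a Rothberger bounded subset of $G$. (4) ONE has no winning strategy in the game $G_1(\mathcal O,\mathcal O_X)$. (5) For each positive integer $k$, $\Omega\to(\mathcal O_X)^2_k$. -/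

import Mathlib

namespace SelectionGames

/-- The selection principle `S₁(𝒜, ℬ)`: for each sequence `(A n)` of members of `𝒜` there are
`b n ∈ A n` such that `{b n : n < ω}` is a member of `ℬ`. -/
def S1 {α : Type*} (𝒜 ℬ : Set (Set α)) : Prop :=
  ∀ A : ℕ → Set α, (∀ n, A n ∈ 𝒜) →
    ∃ b : ℕ → α, (∀ n, b n ∈ A n) ∧ Set.range b ∈ ℬ

/-- A strategy of player ONE in the game `G₁(𝒜, ℬ)`: given the finite sequence
`[T 0, …, T (n - 1)]` of the previous moves of TWO, it returns ONE's next move in `𝒜`. -/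
def IsStrategyOne {α : Type*} (𝒜 : Set (Set α)) (F : List α → Set α) : Prop :=
  ∀ l : List α, F l ∈ 𝒜

/-- `T` is the sequence of moves of TWO in a play of length `ω` in which ONE follows `F`: in
inning `n`, TWO picks a member of `F [T 0, …, T (n - 1)]`. -/
def IsPlayAgainst {α : Type*} (F : List α → Set α) (T : ℕ → α) : Prop :=
  ∀ n : ℕ, T n ∈ F ((List.range n).map T)

/-- ONE has a winning strategy in the game `G₁(𝒜, ℬ)`: TWO wins a play if the set of TWO's moves
is a member of `ℬ`, and otherwise ONE wins. -/
def OneHasWinningStrategy {α : Type*} (𝒜 ℬ : Set (Set α)) : Prop :=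
  ∃ F : List α → Set α, IsStrategyOne 𝒜 F ∧
    ∀ T : ℕ → α, IsPlayAgainst F T → Set.range T ∉ ℬ

/-- `[A]ⁿ`, the family of `n`-element subsets of `A`. -/
def subsetsOfCard {α : Type*} (A : Set α) (n : ℕ) : Set (Set α) :=
  {s | s ⊆ A ∧ s.encard = n}

/-- The partition relation `𝒜 → (ℬ)ⁿ_k`. -/
def PartitionRelation {α : Type*} (𝒜 ℬ : Set (Set α)) (n k : ℕ) : Prop :=
  ∀ A ∈ 𝒜, ∀ f : subsetsOfCard A n → Fin k,
    ∃ B : Set α, B ⊆ A ∧ B ∈ ℬ ∧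
      ∃ i : Fin k, ∀ s : subsetsOfCard A n, (s : Set α) ⊆ B → f s = i

/-- `𝒪_X`: the covers of the subset `X` of `Y` by sets open in `Y`. -/
def openCoversOf {Y : Type*} [TopologicalSpace Y] (X : Set Y) : Set (Set (Set Y)) :=
  {𝒰 | (∀ U ∈ 𝒰, IsOpen U) ∧ X ⊆ ⋃₀ 𝒰}

/-- `𝒪`: the open covers of the space `Y`. -/
def openCovers (Y : Type*) [TopologicalSpace Y] : Set (Set (Set Y)) :=
  openCoversOf (Set.univ : Set Y)

/-- `Ω`: the open `ω`-covers of the space `Y`. -/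
def omegaCovers (Y : Type*) [TopologicalSpace Y] : Set (Set (Set Y)) :=
  {𝒰 | 𝒰 ∈ openCovers Y ∧ Set.univ ∉ 𝒰 ∧ ∀ F : Set Y, F.Finite → ∃ U ∈ 𝒰, F ⊆ U}

/-- `𝒪(U) = {x * U : x ∈ G}`. -/
def leftTranslates {G : Type*} [Group G] (U : Set G) : Set (Set G) :=
  Set.range fun x : G => (fun y : G => x * y) '' U

/-- `𝒪_nbd`: all covers `𝒪(U)` of `G`, where `U` is an open neighborhood of the identity. -/
def nbdCovers (G : Type*) [Group G] [TopologicalSpace G] : Set (Set (Set G)) :=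
  {𝒰 | ∃ U : Set G, IsOpen U ∧ (1 : G) ∈ U ∧ 𝒰 = leftTranslates U}

/-- The subset `X` of the topological group `G` is Rothberger bounded in `G`. -/
def RothbergerBounded {G : Type*} [Group G] [TopologicalSpace G] (X : Set G) : Prop :=
  S1 (nbdCovers G) (openCoversOf X)

end SelectionGames

namespace SelectionGames

open Set Topology

/-! ### Games, partition relations and selection in topological spaces. -/

section Topological

variable {Y : Type*} [TopologicalSpace Y]

/-! The substance is the cycle from Rothberger boundedness to the game, to the partition relation,
to `S1`. Given a strategy of ONE, compactness keeps only finitely many relevant positions per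
inning; one neighborhood of the identity serves them all, and boundedness yields translates that
TWO's moves swallow (`RothbergerBounded.not_oneHasWinningStrategy`). For a colouring of an ω-cover,
ONE plays only sets continuing a homogeneous sequence, kept large by an ultrafilter; a play lost by
ONE is the homogeneous cover. Conversely, a suitable ω-cover codes selections from a sequence of
covers, and a 2-colouring makes them compatible (`s1_of_partitionRelation`). As `G` need not be
Hausdorff, points are told apart only up to inseparability. -/

theorem S1.mono_left {α : Type*} {𝒜 𝒜' ℬ : Set (Set α)} (h : 𝒜' ⊆ 𝒜) (hS : S1 𝒜 ℬ) :
    S1 𝒜' ℬ :=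
  fun A hA => hS A fun n => h (hA n)

theorem exists_mem_of_mem_openCovers {𝒰 : Set (Set Y)} (h : 𝒰 ∈ openCovers Y) (y : Y) :
    ∃ U ∈ 𝒰, y ∈ U :=
  h.2 (mem_univ y)

/-- Some ultrafilter on the subsets of `Y` contains a given `ω`-cover and concentrates on the sets
containing any given finite set. -/
theorem exists_ultrafilter_of_mem_omegaCovers {𝒰 : Set (Set Y)} (h : 𝒰 ∈ omegaCovers Y) :
    ∃ p : Ultrafilter (Set Y), 𝒰 ∈ p ∧ ∀ y : Y, {U : Set Y | y ∈ U} ∈ p := by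
  classical
  let S : Finset Y → Set (Set Y) := fun F => {U | U ∈ 𝒰 ∧ (F : Set Y) ⊆ U}
  have hdir : Directed (· ≥ ·) fun F => Filter.principal (S F) := by
    intro F F'
    refine ⟨F ∪ F', ?_, ?_⟩ <;>
    · simp only [ge_iff_le, Filter.le_principal_iff, Filter.mem_principal]
      intro U hU
      refine ⟨hU.1, fun y hy => hU.2 ?_⟩
      simp only [Finset.coe_union, mem_union]
      tauto
  have hne : (⨅ F, Filter.principal (S F)).NeBot := by
    refine Filter.iInf_neBot_of_directed' hdir fun F => ?_
    rw [Filter.principal_neBot_iff]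
    obtain ⟨U, hU, hF⟩ := h.2.2 F F.finite_toSet
    exact ⟨U, hU, hF⟩
  have key : ∀ F, S F ∈ Ultrafilter.of (⨅ F, Filter.principal (S F)) := fun F =>
    Ultrafilter.of_le _ (Filter.mem_iInf_of_mem F (Filter.mem_principal_self _))
  refine ⟨Ultrafilter.of (⨅ F, Filter.principal (S F)), ?_, fun y => ?_⟩
  · exact Filter.mem_of_superset (key ∅) fun U hU => hU.1
  · exact Filter.mem_of_superset (key {y}) fun U hU => hU.2 (by simp)

theorem mem_openCovers_of_mem_ultrafilter {𝒰 𝒱 : Set (Set Y)} (h : 𝒰 ∈ openCovers Y)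
    {p : Ultrafilter (Set Y)} (hp : ∀ y : Y, {U : Set Y | y ∈ U} ∈ p) (h𝒱 : 𝒱 ∈ p)
    (hsub : 𝒱 ⊆ 𝒰) : 𝒱 ∈ openCovers Y := by
  refine ⟨fun U hU => h.1 U (hsub hU), fun y _ => ?_⟩
  obtain ⟨U, hU, hy⟩ := p.nonempty_of_mem (Filter.inter_mem h𝒱 (hp y))
  exact ⟨U, hU, hy⟩

/-- Ramsey's argument by ultrafilter limits: `c V` is the colour that `V` forms with `p`-almost
every `W`, and `i` is the `p`-almost sure value of `c`. ONE offers the sets of type `i` joined in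
colour `i` to all earlier moves, a `p`-large family and hence a cover. -/
theorem partitionRelation_of_not_oneHasWinningStrategy {X : Set Y}
    (h : ¬ OneHasWinningStrategy (openCovers Y) (openCoversOf X)) {k : ℕ} (hk : 1 ≤ k) :
    PartitionRelation (omegaCovers Y) (openCoversOf X) 2 k := by
  classical
  intro 𝒰 h𝒰 f
  have : NeZero k := ⟨by omega⟩
  obtain ⟨p, hp𝒰, hp⟩ := exists_ultrafilter_of_mem_omegaCovers h𝒰
  let g : Set Y → Set Y → Fin k := fun V W =>
    if hVW : ({V, W} : Set (Set Y)) ∈ subsetsOfCard 𝒰 2 then f ⟨_, hVW⟩ else 0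
  have hcol : ∀ c : Set Y → Fin k, ∃ i, {W | c W = i} ∈ p := by
    intro c
    have : (⋃ i ∈ (univ : Set (Fin k)), {W | c W = i}) ∈ p := by
      have heq : (⋃ i ∈ (univ : Set (Fin k)), {W | c W = i}) = univ := by
        ext W
        simp
      rw [heq]
      exact Filter.univ_mem
    obtain ⟨i, -, hi⟩ := (Ultrafilter.finite_biUnion_mem_iff finite_univ).1 this
    exact ⟨i, hi⟩
  choose c hc using fun V => hcol (g V)
  obtain ⟨i, hi⟩ := hcol c
  -- Since `univ ∉ 𝒰`, the ultrafilter is not principal at a member of `𝒰`.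
  have hne : ∀ V ∈ 𝒰, {W | V ≠ W} ∈ p := by
    intro V hV
    have : V ≠ univ := fun h' => h𝒰.2.1 (h' ▸ hV)
    obtain ⟨y, hy⟩ := (ne_univ_iff_exists_notMem V).1 this
    refine Filter.mem_of_superset (hp y) fun W hW hVW => hy ?_
    rw [hVW]
    exact hW
  let good : Set Y → Set (Set Y) := fun V => {W | V ∈ 𝒰 → c V = i → V ≠ W ∧ g V W = i}
  have hgood : ∀ V, good V ∈ p := by
    intro V
    by_cases hV : V ∈ 𝒰 ∧ c V = i
    · refine Filter.mem_of_superset (Filter.inter_mem (hne V hV.1) (hc V)) ?_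
      rintro W ⟨hW, hW'⟩ - -
      exact ⟨hW, hV.2 ▸ hW'⟩
    · exact Filter.mem_of_superset Filter.univ_mem fun W _ h1 h2 => (hV ⟨h1, h2⟩).elim
  let F : List (Set Y) → Set (Set Y) := fun l =>
    (𝒰 ∩ {W | c W = i}) ∩ ⋂ V ∈ {V | V ∈ l}, good V
  have hF : IsStrategyOne (openCovers Y) F := by
    intro l
    refine mem_openCovers_of_mem_ultrafilter h𝒰.1 hp ?_ fun W hW => hW.1.1
    refine Filter.inter_mem (Filter.inter_mem hp𝒰 hi) ?_
    exact (Filter.biInter_mem l.finite_toSet).2 fun V _ => hgood V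
  have : ∃ T, IsPlayAgainst F T ∧ range T ∈ openCoversOf X := by
    by_contra! hcon
    exact h ⟨F, hF, hcon⟩
  obtain ⟨T, hT, hTX⟩ := this
  have hT𝒰 : ∀ n, T n ∈ 𝒰 := fun n => (hT n).1.1
  have hlt : ∀ m n, m < n → T m ≠ T n ∧ g (T m) (T n) = i := by
    intro m n hmn
    have hmem : T n ∈ good (T m) := by
      refine mem_iInter₂.1 (hT n).2 (T m) ?_
      exact List.mem_map_of_mem (List.mem_range.2 hmn)
    exact hmem (hT𝒰 m) (hT m).1.2
  refine ⟨range T, ?_, hTX, i, ?_⟩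
  · rintro _ ⟨n, rfl⟩
    exact hT𝒰 n
  · rintro ⟨s, hs⟩ hsT
    have hs2 := hs.2
    obtain ⟨V, W, hVW, rfl⟩ := encard_eq_two.1 (by simpa using hs2)
    obtain ⟨m, rfl⟩ := hsT (show V ∈ ({V, W} : Set (Set Y)) by simp)
    obtain ⟨n, rfl⟩ := hsT (show W ∈ ({T m, W} : Set (Set Y)) by simp)
    have hg : ∀ m n (hmn : ({T m, T n} : Set (Set Y)) ∈ subsetsOfCard 𝒰 2), m < n →
        f ⟨_, hmn⟩ = i := by
      intro m n hmn hlt'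
      have := (hlt m n hlt').2
      simpa only [g, dif_pos hmn] using this
    rcases lt_trichotomy m n with h' | h' | h'
    · exact hg m n hs h'
    · exact (hVW (by rw [h'])).elim
    · have heq : ({T m, T n} : Set (Set Y)) = {T n, T m} := pair_comm _ _
      have := hg n m (heq ▸ hs) h'
      rw [← this]
      congr 1
      exact Subtype.ext heq

theorem s1_of_forall_exists_inseparable {X : Set Y} (y : ℕ → Y)
    (hy : ∀ x ∈ X, ∃ n, Inseparable x (y n)) : S1 (openCovers Y) (openCoversOf X) := by
  intro A hA
  choose b hb hyb using fun n => exists_mem_of_mem_openCovers (hA n) (y n)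
  refine ⟨b, hb, ?_, fun x hx => ?_⟩
  · rintro _ ⟨n, rfl⟩
    exact (hA n).1 _ (hb n)
  · obtain ⟨n, hn⟩ := hy x hx
    exact ⟨b n, ⟨n, rfl⟩, (hn.mem_open_iff ((hA n).1 _ (hb n))).2 (hyb n)⟩

/-- Members of the ω-cover are finite unions of choices from row `n` of the covers, with the closure
of `x n` removed. Pairs are coloured by whether their rows agree. A homogeneous cover cannot live in
one row, since it would miss `x n`; so it has at most one member per row, and their choices combine.
-/
theorem s1_of_partitionRelation_of_pairwise_not_inseparable [R0Space Y] {X : Set Y}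
    (h : PartitionRelation (omegaCovers Y) (openCoversOf X) 2 2) (x : ℕ → Y) (hxX : ∀ n, x n ∈ X)
    (hx : ∀ m n, Inseparable (x m) (x n) → m = n) : S1 (openCovers Y) (openCoversOf X) := by
  classical
  intro A hA
  have hclosure : ∀ n y, y ∈ closure {x n} ↔ Inseparable y (x n) := fun n y => by
    rw [← specializes_iff_mem_closure, specializes_iff_inseparable]
    exact ⟨Inseparable.symm, Inseparable.symm⟩
  let R : ℕ → (ℕ → Set Y) → ℕ → Set Y := fun n v J =>
    (closure {x n})ᶜ ∩ ⋃ j ∈ Iio J, v j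
  let 𝒱 : Set (Set Y) := {S | ∃ n v J, (∀ j, v j ∈ A (Nat.pair n j)) ∧ S = R n v J}
  have hRX : ∀ n v J, x n ∉ R n v J := fun n v J hn => hn.1 (subset_closure rfl)
  have hopen : ∀ S ∈ 𝒱, IsOpen S := by
    rintro _ ⟨n, v, J, hv, rfl⟩
    exact isClosed_closure.isOpen_compl.inter
      (isOpen_biUnion fun j _ => (hA _).1 _ (hv j))
  have hfin : ∀ F : Set Y, F.Finite → ∃ S ∈ 𝒱, F ⊆ S := by
    intro F hF
    have hn : ∃ n, F ⊆ (closure {x n})ᶜ := by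
      by_contra! hcon
      have : ∀ n, ∃ y ∈ F, Inseparable y (x n) := fun n => by
        obtain ⟨y, hyF, hy⟩ := not_subset.1 (hcon n)
        exact ⟨y, hyF, (hclosure n y).1 (not_not.1 hy)⟩
      choose y hyF hy using this
      have hinj : Function.Injective y := fun m n hmn =>
        hx m n ((hy m).symm.trans (hmn ▸ hy n))
      exact infinite_range_of_injective hinj (hF.subset (range_subset_iff.2 hyF))
    obtain ⟨n, hn⟩ := hn
    obtain ⟨J, e, he⟩ : ∃ (J : ℕ) (e : ℕ → Y), ∀ z ∈ F, ∃ j < J, e j = z := by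
      obtain ⟨J, e, -, rfl⟩ := hF.fin_param
      refine ⟨J, fun j => if hj : j < J then e ⟨j, hj⟩ else x 0, ?_⟩
      rintro _ ⟨j, rfl⟩
      exact ⟨j, j.2, by simp⟩
    choose v hv hev using fun j => exists_mem_of_mem_openCovers (hA (Nat.pair n j)) (e j)
    refine ⟨_, ⟨n, v, J, hv, rfl⟩, fun z hz => ⟨hn hz, ?_⟩⟩
    obtain ⟨j, hj, rfl⟩ := he z hz
    exact mem_biUnion (mem_Iio.2 hj) (hev j)
  have h𝒱 : 𝒱 ∈ omegaCovers Y := by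
    refine ⟨⟨hopen, fun y _ => ?_⟩, ?_, hfin⟩
    · obtain ⟨S, hS, hyS⟩ := hfin {y} (finite_singleton y)
      exact ⟨S, hS, hyS rfl⟩
    · rintro ⟨n, v, J, hv, hS⟩
      exact hRX n v J (hS ▸ mem_univ _)
  choose! N v J hv hS using fun S (hS : S ∈ 𝒱) => hS
  let f : subsetsOfCard 𝒱 2 → Fin 2 := fun s =>
    if ∀ V ∈ s.1, ∀ W ∈ s.1, N V = N W then 0 else 1
  obtain ⟨B, hB𝒱, hB, i, hi⟩ := h 𝒱 h𝒱 f
  have hpair : ∀ V ∈ B, ∀ W ∈ B, V ≠ W →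
      ∃ hs : ({V, W} : Set (Set Y)) ∈ subsetsOfCard 𝒱 2, f ⟨_, hs⟩ = i := by
    intro V hV W hW hVW
    have hsub : ({V, W} : Set (Set Y)) ⊆ B := pair_subset hV hW
    exact ⟨⟨hsub.trans hB𝒱, by simpa using encard_pair hVW⟩, hi _ hsub⟩
  have hinj : ∀ V ∈ B, ∀ W ∈ B, N V = N W → V = W := by
    intro V hV W hW hN
    by_contra hVW
    obtain ⟨hs, hfs⟩ := hpair V hV W hW hVW
    have hi0 : i = 0 := by
      rw [← hfs]
      refine if_pos ?_
      rintro _ (rfl | rfl) _ (rfl | rfl) <;> simp [hN]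
    have hall : ∀ W ∈ B, N V = N W := by
      intro W hW
      by_cases hVW : V = W
      · rw [hVW]
      obtain ⟨hs, hfs⟩ := hpair V hV W hW hVW
      by_contra hne
      have : f ⟨_, hs⟩ = 1 := if_neg fun hcon =>
        hne (hcon V (by simp) W (by simp))
      rw [hfs, hi0] at this
      exact absurd this (by decide)
    obtain ⟨W, hW, hxW⟩ := hB.2 (hxX (N V))
    rw [hS W (hB𝒱 hW), ← hall W hW] at hxW
    exact hRX _ _ _ hxW
  -- Fillers for the rows not represented in `B`.
  choose d hd _ using fun n => exists_mem_of_mem_openCovers (hA n) (x 0)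
  have hb : ∀ n, ∃ b ∈ A n, ∀ V ∈ B, N V = (Nat.unpair n).1 → v V (Nat.unpair n).2 = b := by
    intro n
    by_cases hV : ∃ V ∈ B, N V = (Nat.unpair n).1
    · obtain ⟨V, hVB, hV⟩ := hV
      refine ⟨v V (Nat.unpair n).2, ?_, fun W hW hWN => ?_⟩
      · simpa [hV] using hv V (hB𝒱 hVB) (Nat.unpair n).2
      · rw [hinj W hW V hVB (hWN.trans hV.symm)]
    · exact ⟨d n, hd n, fun V hVB hVN => (hV ⟨V, hVB, hVN⟩).elim⟩
  choose b hbA hb using hb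
  refine ⟨b, hbA, ?_, fun z hz => ?_⟩
  · rintro _ ⟨n, rfl⟩
    exact (hA n).1 _ (hbA n)
  · obtain ⟨V, hV, hzV⟩ := hB.2 hz
    rw [hS V (hB𝒱 hV)] at hzV
    obtain ⟨j, -, hj⟩ := mem_iUnion₂.1 hzV.2
    refine ⟨_, ⟨Nat.pair (N V) j, rfl⟩, ?_⟩
    rw [← hb (Nat.pair (N V) j) V hV (by simp)]
    simpa using hj

theorem s1_of_partitionRelation [R0Space Y] [Nonempty Y] {X : Set Y}
    (h : PartitionRelation (omegaCovers Y) (openCoversOf X) 2 2) :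
    S1 (openCovers Y) (openCoversOf X) := by
  by_cases hX : (SeparationQuotient.mk '' X).Finite
  · inhabit Y
    -- The extra point makes the set nonempty, hence the range of a sequence, even for empty `X`.
    obtain ⟨q, hq⟩ := (hX.countable.insert (SeparationQuotient.mk default)).exists_eq_range
      (insert_nonempty _ _)
    choose y hy using fun n => SeparationQuotient.surjective_mk (q n)
    refine s1_of_forall_exists_inseparable y fun x hx => ?_
    obtain ⟨n, hn⟩ : SeparationQuotient.mk x ∈ range q := by
      rw [← hq]
      exact mem_insert_of_mem _ (mem_image_of_mem _ hx)
    exact ⟨n, SeparationQuotient.mk_eq_mk.1 (by rw [hy, hn])⟩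
  · have e := Set.Infinite.natEmbedding _ hX
    choose x hxX hx using fun n => (e n).2
    refine s1_of_partitionRelation_of_pairwise_not_inseparable h x hxX fun m n hmn => ?_
    refine e.injective (Subtype.ext ?_)
    rw [← hx m, ← hx n, SeparationQuotient.mk_eq_mk.2 hmn]

end Topological

/-! ### Rothberger boundedness and the game in σ-compact groups. -/

section Group

variable {G : Type*} [Group G] [TopologicalSpace G]

open scoped Pointwise

theorem leftTranslates_mem_openCovers [IsTopologicalGroup G] {U : Set G} (hU : IsOpen U)
    (h1 : (1 : G) ∈ U) : leftTranslates U ∈ openCovers G := by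
  refine ⟨?_, fun x _ => ⟨_, ⟨x, rfl⟩, 1, h1, mul_one x⟩⟩
  rintro _ ⟨x, rfl⟩
  exact isOpenMap_mul_left x U hU

theorem nbdCovers_subset_openCovers [IsTopologicalGroup G] : nbdCovers G ⊆ openCovers G := by
  rintro _ ⟨U, hU, h1, rfl⟩
  exact leftTranslates_mem_openCovers hU h1

/-- A Lebesgue number lemma for left translates, providing also a finite subfamily. -/
theorem exists_nhds_one_forall_translate_subset [IsTopologicalGroup G] {K : Set G}
    (hK : IsCompact K) {𝒰 : Set (Set G)} (h𝒰 : 𝒰 ∈ openCovers G) :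
    ∃ (V : Set G) (𝒲 : Set (Set G)), IsOpen V ∧ (1 : G) ∈ V ∧ 𝒲 ⊆ 𝒰 ∧ 𝒲.Finite ∧
      ∀ S : Set G, (S ∈ leftTranslates V) → (S ∩ K).Nonempty → ∃ W ∈ 𝒲, S ⊆ W := by
  -- If `x * V` meets `K` in `x * b = y * a`, then `x * c = y * a * b⁻¹ * c` for every `c ∈ V`.
  have hex : ∀ y : G, ∃ W ∈ 𝒰, ∃ V : Set G, IsOpen V ∧ (1 : G) ∈ V ∧
      ∀ a ∈ V, ∀ b ∈ V, ∀ c ∈ V, y * a * b⁻¹ * c ∈ W := by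
    intro y
    obtain ⟨W, hW, hy⟩ := exists_mem_of_mem_openCovers h𝒰 y
    have hcont : Continuous fun t : G × G × G => y * t.1 * t.2.1⁻¹ * t.2.2 := by fun_prop
    have hmem : (fun t : G × G × G => y * t.1 * t.2.1⁻¹ * t.2.2) ⁻¹' W ∈
        𝓝 ((1, 1, 1) : G × G × G) :=
      hcont.continuousAt.preimage_mem_nhds ((h𝒰.1 W hW).mem_nhds (by simpa using hy))
    rw [nhds_prod_eq, nhds_prod_eq] at hmem
    obtain ⟨V₁, hV₁, V₂₃, hV₂₃, hsub⟩ := Filter.mem_prod_iff.1 hmem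
    obtain ⟨V₂, hV₂, V₃, hV₃, hsub'⟩ := Filter.mem_prod_iff.1 hV₂₃
    obtain ⟨V, hV, hVo, hV1⟩ :=
      mem_nhds_iff.1 (Filter.inter_mem hV₁ (Filter.inter_mem hV₂ hV₃))
    refine ⟨W, hW, V, hVo, hV1, fun a ha b hb c hc => ?_⟩
    have : (a, b, c) ∈ V₁ ×ˢ V₂₃ := ⟨(hV ha).1, hsub' ⟨(hV hb).2.1, (hV hc).2.2⟩⟩
    exact hsub this
  choose W hW V hVo hV1 hV using hex
  obtain ⟨t, ht⟩ := hK.elim_finite_subcover (fun y => (fun z => y * z) '' V y)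
    (fun y => isOpenMap_mul_left y _ (hVo y))
    fun y _ => mem_iUnion.2 ⟨y, 1, hV1 y, mul_one y⟩
  refine ⟨⋂ y ∈ t, V y, W '' t, isOpen_biInter_finset fun y _ => hVo y,
    mem_iInter₂.2 fun y _ => hV1 y, ?_, t.finite_toSet.image W, ?_⟩
  · rintro _ ⟨y, -, rfl⟩
    exact hW y
  · rintro _ ⟨x, rfl⟩ ⟨_, ⟨b, hb, rfl⟩, hK'⟩
    obtain ⟨y, hyt, a, ha, hab⟩ := mem_iUnion₂.1 (ht hK')
    refine ⟨W y, mem_image_of_mem W hyt, ?_⟩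
    rintro _ ⟨c, hc, rfl⟩
    have hx : x = y * a * b⁻¹ := by
      rw [eq_mul_inv_iff_mul_eq]
      exact hab.symm
    have := hV y a ha b (mem_iInter₂.1 hb y hyt) c (mem_iInter₂.1 hc y hyt)
    rwa [← hx] at this

/-- Boundedness is applied to each row of the pairing separately, so every point of `X` is caught in
every row; row `m` can then be devoted to the `m`-th compact set. -/
theorem RothbergerBounded.exists_translates {X : Set G} (hX : RothbergerBounded X)
    (V : ℕ → Set G) (hVo : ∀ n, IsOpen (V n)) (hV1 : ∀ n, (1 : G) ∈ V n) :
    ∃ S : ℕ → Set G, (∀ n, S n ∈ leftTranslates (V n)) ∧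
      ∀ m, ∀ x ∈ X, ∃ j, x ∈ S (Nat.pair m j) := by
  choose b hb hbX using fun m => hX (fun j => leftTranslates (V (Nat.pair m j)))
    fun j => ⟨_, hVo _, hV1 _, rfl⟩
  refine ⟨fun n => b n.unpair.1 n.unpair.2, fun n => ?_, fun m x hx => ?_⟩
  · simpa using hb n.unpair.1 n.unpair.2
  · obtain ⟨_, ⟨j, rfl⟩, hj⟩ := (hbX m).2 hx
    exact ⟨j, by simpa using hj⟩

theorem RothbergerBounded.not_oneHasWinningStrategy [IsTopologicalGroup G] [SigmaCompactSpace G]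
    {X : Set G} (hX : RothbergerBounded X) :
    ¬ OneHasWinningStrategy (openCovers G) (openCoversOf X) := by
  rintro ⟨F, hF, hwin⟩
  -- Adjoining `1` makes the compact set nonempty, so that `𝒲 l` is nonempty and TWO has a move even
  -- when the translate misses the compact set.
  choose V 𝒲 hVo hV1 h𝒲 h𝒲fin hV using fun l : List (Set G) =>
    exists_nhds_one_forall_translate_subset
      ((isCompact_compactCovering G l.length.unpair.1).insert 1) (hF l)
  -- the positions of length `n` in which TWO has always moved inside the finite subfamilies `𝒲`
  let P : ℕ → Set (List (Set G)) := fun n =>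
    Nat.rec (motive := fun _ => Set (List (Set G))) {[]}
    (fun _ Q => ⋃ l ∈ Q, (fun W => l ++ [W]) '' 𝒲 l) n
  have hPsucc : ∀ n, P (n + 1) = ⋃ l ∈ P n, (fun W => l ++ [W]) '' 𝒲 l := fun n => rfl
  have hPfin : ∀ n, (P n).Finite := by
    intro n
    induction n with
    | zero => exact finite_singleton _
    | succ n ih =>
      rw [hPsucc]
      exact ih.biUnion fun l _ => (h𝒲fin l).image _
  have hPlen : ∀ n, ∀ l ∈ P n, l.length = n := by
    intro n
    induction n with
    | zero =>
      rintro _ rfl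
      rfl
    | succ n ih =>
      intro l hl
      rw [hPsucc] at hl
      obtain ⟨l', hl', W, -, rfl⟩ := mem_iUnion₂.1 hl
      simp [ih l' hl']
  obtain ⟨S, hS, hSX⟩ := hX.exists_translates (fun n => ⋂ l ∈ P n, V l)
    (fun n => (hPfin n).isOpen_biInter fun l _ => hVo l)
    fun n => mem_iInter₂.2 fun l _ => hV1 l
  have hmove : ∀ (n : ℕ) (l : List (Set G)), ∃ W : Set G, l ∈ P n → W ∈ 𝒲 l ∧
      ((S n ∩ compactCovering G n.unpair.1).Nonempty → S n ⊆ W) := by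
    intro n l
    rcases Classical.em (l ∈ P n) with hl | hl
    swap
    · exact ⟨∅, fun h => (hl h).elim⟩
    have hlen := hPlen n l hl
    obtain ⟨x, hx⟩ := hS n
    by_cases hne : (S n ∩ compactCovering G n.unpair.1).Nonempty
    · obtain ⟨W, hW, hsub⟩ := hV l _ ⟨x, rfl⟩ (by
        refine hne.mono ?_
        rw [← hx, hlen]
        exact inter_subset_inter (image_mono (biInter_subset_of_mem hl)) (subset_insert _ _))
      refine ⟨W, fun _ => ⟨hW, fun _ => ?_⟩⟩
      rw [← hx]
      exact (image_mono (biInter_subset_of_mem hl)).trans hsub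
    · obtain ⟨W, hW, -⟩ := hV l _ ⟨1, rfl⟩ ⟨1, ⟨1, hV1 l, mul_one 1⟩, mem_insert _ _⟩
      exact ⟨W, fun _ => ⟨hW, fun h => (hne h).elim⟩⟩
  choose w hw using hmove
  let pos : ℕ → List (Set G) := fun n =>
    Nat.rec (motive := fun _ => List (Set G)) [] (fun n l => l ++ [w n l]) n
  have hpos : ∀ n, pos (n + 1) = pos n ++ [w n (pos n)] := fun n => rfl
  have hposP : ∀ n, pos n ∈ P n := by
    intro n
    induction n with
    | zero => exact rfl
    | succ n ih =>
      rw [hPsucc, hpos]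
      exact mem_iUnion₂.2 ⟨pos n, ih, _, (hw n _ ih).1, rfl⟩
  have hposmap : ∀ n, (List.range n).map (fun n => w n (pos n)) = pos n := by
    intro n
    induction n with
    | zero => rfl
    | succ n ih => rw [List.range_succ, List.map_append, ih, hpos, List.map_singleton]
  have hplay : IsPlayAgainst F fun n => w n (pos n) := by
    intro n
    rw [hposmap]
    exact h𝒲 _ (hw n _ (hposP n)).1
  refine hwin _ hplay ⟨?_, fun x hx => ?_⟩
  · rintro _ ⟨n, rfl⟩
    exact (hF _).1 _ (hplay n)
  · obtain ⟨m, hm⟩ := mem_iUnion.1 ((iUnion_compactCovering G).symm ▸ mem_univ x)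
    obtain ⟨j, hj⟩ := hSX m x hx
    exact ⟨_, ⟨Nat.pair m j, rfl⟩,
      (hw _ _ (hposP _)).2 ⟨x, hj, by simpa using hm⟩ hj⟩

end Group

end SelectionGames

theorem theorem3 {G : Type*} [Group G] [TopologicalSpace G] [IsTopologicalGroup G]
    [SigmaCompactSpace G] (X : Set G) :
    List.TFAE [
      SelectionGames.S1 (SelectionGames.openCovers G) (SelectionGames.openCoversOf X),
      SelectionGames.S1 (SelectionGames.nbdCovers G) (SelectionGames.openCoversOf X),
      SelectionGames.RothbergerBounded X,
      ¬ SelectionGames.OneHasWinningStrategy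
          (SelectionGames.openCovers G) (SelectionGames.openCoversOf X),
      ∀ k : ℕ, 1 ≤ k →
        SelectionGames.PartitionRelation
          (SelectionGames.omegaCovers G) (SelectionGames.openCoversOf X) 2 k] := by
  tfae_have 1 → 2 := SelectionGames.S1.mono_left SelectionGames.nbdCovers_subset_openCovers
  tfae_have 2 → 3 := id
  tfae_have 3 → 4 := SelectionGames.RothbergerBounded.not_oneHasWinningStrategy
  tfae_have 4 → 5 := fun h _ hk =>
    SelectionGames.partitionRelation_of_not_oneHasWinningStrategy h hk
  tfae_have 5 → 1 := fun h => SelectionGames.s1_of_partitionRelation (h 2 (by norm_num))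
  tfae_finish
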